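/- For a real matrix $M$ let $\|M\|_F=(\sum_{i,j}M_{ij}^2)^{1/2}$. A probability distribution $\mathcal S$ over real $m\times d$ matrices has the $\varepsilon$-AMM property for $d\times n$ matrices if for every fixed $A\in\mathbb R^{d\times n}$, $$\Pr_{\mathbf S\sim\mathcal S}\bigl[\|A^{T}\mathbf S^{T}\mathbf S A-A^{T}A\|_F\le\varepsilon\|A\|_F^2\bigr]\ge \tfrac{9}{10}.$$ (a) There are universal constants $c,C,D>0$ such that for all integers $n\ge1$, all real $0<\varepsilon<c/\sqrt n$, all integers $d\ge D/\varepsilon^2$ and all integers $m\ge 0$: if some distribution over $m\times d$ matrices has the $\varepsilon$-AMM property for $d\times n$ matrices, then $m\ge C/\varepsilon^2$. (b) There are universal constants $c,C,D>0$ such that for all integers $n\ge1$, all real $0<\varepsilon\le c/\sqrt n$, all integers $d\ge Dn/\varepsilon^2$, all integers $m\ge 0$ and every distribution $\mathcal S$ over $m\times d$ matrices: (i) if $\mathcal S$ has the $\varepsilon$-AMM property for $d\times n$ matrices, then $m\ge C/\varepsilon^2$; (ii) the same bound $m\ge C/\varepsilon^2$ holds already if $$\Pr_{\mathbf A,\mathbf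 S}\bigl[\|\mathbf A^{T}\mathbf S^{T}\mathbf S\mathbf A-I_n\|_F\le\varepsilon n\bigr]\ge \tfrac{9}{10},$$ where $\mathbf S\sim\mathcal S$ and $\mathbf A$, independent of $\mathbf S$, is a uniformly random $d\times n$ matrix with orthonormal columns (the first $n$ columns of a Haar-distributed $d\times d$ orthogonal matrix). -/

import Mathlib

open MeasureTheory
open scoped Matrix

noncomputable section

/-- The Frobenius norm `(∑ i j, A i j ^ 2) ^ (1/2)` of a real matrix. -/
def frobNorm {p q : ℕ} (A : Matrix (Fin p) (Fin q) ℝ) : ℝ :=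
  Real.sqrt (∑ i, ∑ j, A i j ^ 2)

/-- `frobNorm` is Mathlib's Frobenius norm, which is not a global instance. -/
theorem frobNorm_eq_frobenius {p q : ℕ} (A : Matrix (Fin p) (Fin q) ℝ) :
    frobNorm A = (Matrix.frobeniusNormedAddCommGroup (m := Fin p) (n := Fin q) (α := ℝ)).norm A := by
  have h := Matrix.frobenius_norm_def A
  rw [frobNorm, Real.sqrt_eq_rpow]
  simpa using h.symm

/-- Real matrices carry the product (equivalently, Borel) σ-algebra. -/
instance matrixMeasurableSpace {p q : ℕ} : MeasurableSpace (Matrix (Fin p) (Fin q) ℝ) :=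
  inferInstanceAs (MeasurableSpace (Fin p → Fin q → ℝ))

instance matrixBorelSpace {p q : ℕ} : BorelSpace (Matrix (Fin p) (Fin q) ℝ) :=
  inferInstanceAs (BorelSpace (Fin p → Fin q → ℝ))

/-- The sketching matrix `S` satisfies the `ε`-AMM (approximate matrix multiplication) property
for the pair `(A, B)`. -/
def SatisfiesAMM {m d p q : ℕ} (ε : ℝ) (S : Matrix (Fin m) (Fin d) ℝ)
    (A : Matrix (Fin d) (Fin p) ℝ) (B : Matrix (Fin d) (Fin q) ℝ) : Prop :=
  frobNorm (Aᵀ * Sᵀ * S * B - Aᵀ * B) ≤ ε * (frobNorm A * frobNorm B)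

/-- The distribution `μ` over `m × d` sketching matrices is an oblivious sketch with the
`(ε, δ)`-AMM property for `d × n` matrices: for every fixed `d × n` matrix `A`, a sample `S`
satisfies `‖Aᵀ Sᵀ S A - Aᵀ A‖_F ≤ ε ‖A‖_F ^ 2` with probability at least `1 - δ`.
The guarantee is asked for pairs `(A, A)` only, so it is implied by the one for all pairs
`(A, B)`; a lower bound for sketches with this property is the stronger statement. -/
def HasAMM {m d : ℕ} (μ : Measure (Matrix (Fin m) (Fin d) ℝ)) (n : ℕ) (ε δ : ℝ) : Prop :=
  ∀ A : Matrix (Fin d) (Fin n) ℝ, 1 - δ ≤ μ.real {S | SatisfiesAMM ε S A A}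

/-- The real orthogonal group is compact. -/
instance orthogonalGroup_compactSpace (d : ℕ) :
    CompactSpace (Matrix.orthogonalGroup (Fin d) ℝ) := by
  have hc : IsClosed {A : Matrix (Fin d) (Fin d) ℝ | A ∈ Matrix.orthogonalGroup (Fin d) ℝ} := by
    have : {A : Matrix (Fin d) (Fin d) ℝ | A ∈ Matrix.orthogonalGroup (Fin d) ℝ}
        = {A | A * star A = 1} := by
      ext A; exact Matrix.mem_unitaryGroup_iff
    rw [this]
    exact isClosed_eq (by fun_prop) continuous_const
  have hb : IsCompact (Set.pi Set.univ fun _ : Fin d => Set.pi Set.univ fun _ : Fin d =>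
      Set.Icc (-1 : ℝ) 1) :=
    isCompact_univ_pi fun _ => isCompact_univ_pi fun _ => isCompact_Icc
  refine isCompact_iff_compactSpace.mp (hb.of_isClosed_subset hc ?_)
  intro A hA i _ j _
  exact abs_le.mp (entry_norm_bound_of_unitary (𝕜 := ℝ) hA i j)

/-- Haar probability measure on the real orthogonal group. -/
def haarOrthogonal (d : ℕ) : Measure (Matrix.orthogonalGroup (Fin d) ℝ) :=
  Measure.haarMeasure ⊤

instance haarOrthogonal_isHaarMeasure (d : ℕ) : (haarOrthogonal d).IsHaarMeasure :=
  inferInstanceAs (Measure.haarMeasure ⊤).IsHaarMeasure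

instance haarOrthogonal_isProbabilityMeasure (d : ℕ) :
    IsProbabilityMeasure (haarOrthogonal d) :=
  ⟨by simpa [haarOrthogonal] using
    Measure.haarMeasure_self (K₀ := (⊤ : TopologicalSpace.PositiveCompacts
      (Matrix.orthogonalGroup (Fin d) ℝ)))⟩

/-- The first `n` columns of a `d × d` matrix, for `n ≤ d` (padded by zero columns otherwise). -/
def firstColumns {d : ℕ} (n : ℕ) (Q : Matrix (Fin d) (Fin d) ℝ) : Matrix (Fin d) (Fin n) ℝ :=
  fun i j => if h : (j : ℕ) < d then Q i ⟨j, h⟩ else 0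

theorem measurable_firstColumns_coe (d n : ℕ) :
    Measurable fun Q : Matrix.orthogonalGroup (Fin d) ℝ =>
      firstColumns n (Q : Matrix (Fin d) (Fin d) ℝ) := by
  refine Continuous.measurable (continuous_matrix fun i j => ?_)
  by_cases h : (j : ℕ) < d
  · simp only [firstColumns, h, dite_true]
    exact continuous_subtype_val.matrix_elem i _
  · simp only [firstColumns, h, dite_false]
    exact continuous_const

/-- The law of a uniformly random `d × n` orthonormal matrix (`n ≤ d`): the first `n` columns of
a Haar-distributed orthogonal `d × d` matrix. -/
def uniformOrthonormal (d n : ℕ) : Measure (Matrix (Fin d) (Fin n) ℝ) :=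
  Measure.map (fun Q : Matrix.orthogonalGroup (Fin d) ℝ =>
    firstColumns n (Q : Matrix (Fin d) (Fin d) ℝ)) (haarOrthogonal d)

instance uniformOrthonormal_isProbabilityMeasure (d n : ℕ) :
    IsProbabilityMeasure (uniformOrthonormal d n) :=
  Measure.isProbabilityMeasure_map (measurable_firstColumns_coe d n).aemeasurable

end

/-!
The random orthonormal guarantee is shown to force `m ≥ C / ε ^ 2`; the other claims follow from it.
By Fubini's theorem it is implied by the guarantee for every fixed matrix
(`HasAMM.random_orthonormal`), and by zero padding the latter passes from `n` columns to one
(`HasAMM.mono_columns`), which removes the factor `n` from the requirement on `d`.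

Fix a sketch `S` with `m < C / ε ^ 2` rows, let `Q` be a Haar orthogonal matrix and put `N = S Q`,
`M = Nᵀ N`. It is enough that `S` fails on the first `n` columns of `Q` with probability bounded
below by a constant larger than `1 / 10`, uniformly in `S`; then one integrates over `S`.

*Reduction to two columns.* If `n ≥ 2` and the leading `n × n` block of `M` is within `ε n` of the
identity then, by Markov's inequality, most pairs `i ≠ j` satisfy `|M i i - 1| ≤ 1 / 2` and
`|M i j| ≤ 4 ε` (`card_bad_pairs_le`). If `n = 1`, the same is obtained by polarization from the
three unit vectors `x`, `(x + y) / √2`, `(x - y) / √2`, whose images have the same law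
(`haarOrthogonal_abs_gramForm_sub_one_le`). So one has to bound the probability that two columns of
`Q` are mapped by `S` to such a nearly orthonormal pair.

*Replacing Haar measure by finite randomness.* Haar measure is invariant under right
multiplication, hence that probability is the same for the images of any orthonormal pair `(x, y)`,
and one may average over `x = e_k` and `y` a sign vector on the remaining coordinates, scaled to
length one (`haarOrthogonal_nearlyOrthonormal_le`). What is left is a statement on each fixed `M`.

*Leverage scores and sign sums.* As `N` has `m` rows, `M k k ^ 2 ≤ ℓ k * ∑ l, M k l ^ 2` with
`∑ k, ℓ k ≤ m` (`exists_leverage_scores`). So for most `k` either `M k k` is far from `1` or the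
`k`-th row of `M` has squared length of order at least `d / m`, nearly all of it off the diagonal.
In the latter case the pairing of this row with the random sign vector has variance of order at
least `1 / m`, which is much larger than `ε ^ 2`. The second and fourth moments of a sign sum then
show that it exceeds `4 ε` in absolute value for almost a third of the signs
(`card_signSum_sq_le`).
-/

/-! ### Sign sums -/

/-- The sign `1` or `-1` encoded by a Boolean. -/
def boolSign (b : Bool) : ℝ := if b then 1 else -1

theorem boolSign_sq (b : Bool) : boolSign b ^ 2 = 1 := by cases b <;> simp [boolSign]

/-- The sign sum `∑ l, ± a l` with the signs given by `s`. -/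
def signSum {d : ℕ} (a : Fin d → ℝ) (s : Fin d → Bool) : ℝ := ∑ l, boolSign (s l) * a l

theorem sum_signs_succ {d : ℕ} (F : (Fin (d + 1) → Bool) → ℝ) :
    ∑ s, F s = ∑ t : Fin d → Bool, (F (Fin.cons true t) + F (Fin.cons false t)) := by
  rw [← (Fin.consEquiv fun _ => Bool).sum_comp, Fintype.sum_prod_type]
  simp [Fin.consEquiv, Finset.sum_add_distrib]

theorem signSum_cons {d : ℕ} (a : Fin (d + 1) → ℝ) (b : Bool) (t : Fin d → Bool) :
    signSum a (Fin.cons b t : Fin (d + 1) → Bool)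
      = boolSign b * a 0 + signSum (fun l => a l.succ) t := by
  simp [signSum, Fin.sum_univ_succ]

theorem sum_signSum_sq {d : ℕ} (a : Fin d → ℝ) :
    ∑ s, signSum a s ^ 2 = 2 ^ d * ∑ l, a l ^ 2 := by
  induction d with
  | zero => simp [signSum]
  | succ d ih =>
    rw [sum_signs_succ, Fin.sum_univ_succ]
    have h (t : Fin d → Bool) : signSum a (Fin.cons true t : Fin (d + 1) → Bool) ^ 2
        + signSum a (Fin.cons false t : Fin (d + 1) → Bool) ^ 2
        = 2 * a 0 ^ 2 + 2 * signSum (fun l => a l.succ) t ^ 2 := by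
      simp only [signSum_cons, boolSign]; simp; ring
    simp only [h, Finset.sum_add_distrib, ← Finset.mul_sum, ih]
    simp; ring

theorem sum_signSum_pow_four_le {d : ℕ} (a : Fin d → ℝ) :
    ∑ s, signSum a s ^ 4 ≤ 3 * 2 ^ d * (∑ l, a l ^ 2) ^ 2 := by
  induction d with
  | zero => simp [signSum]
  | succ d ih =>
    rw [sum_signs_succ, Fin.sum_univ_succ]
    have h (t : Fin d → Bool) : signSum a (Fin.cons true t : Fin (d + 1) → Bool) ^ 4
        + signSum a (Fin.cons false t : Fin (d + 1) → Bool) ^ 4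
        = 2 * a 0 ^ 4 + 12 * a 0 ^ 2 * signSum (fun l => a l.succ) t ^ 2
          + 2 * signSum (fun l => a l.succ) t ^ 4 := by
      simp only [signSum_cons, boolSign]; simp; ring
    simp only [h, Finset.sum_add_distrib, ← Finset.mul_sum, sum_signSum_sq]
    have h2 := ih fun l => a l.succ
    have h3 : 0 ≤ (2 : ℝ) ^ d * a 0 ^ 4 := by positivity
    simp only [Finset.sum_const, Finset.card_univ, Fintype.card_pi, Fintype.card_bool,
      Finset.prod_const, Fintype.card_fin, nsmul_eq_mul, Nat.cast_pow, Nat.cast_ofNat, pow_succ] at *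
    nlinarith

/-- Anticoncentration of a sign sum: a Paley–Zygmund inequality from the second and fourth
moments. -/
theorem card_signSum_sq_le {d : ℕ} (a : Fin d → ℝ) (ha : 0 < ∑ l, a l ^ 2) {θ : ℝ}
    (hθ : 0 ≤ θ) :
    (∑ s, if signSum a s ^ 2 ≤ θ * ∑ l, a l ^ 2 then (1 : ℝ) else 0)
      ≤ (2 / 3 + 2 / 3 * θ) * 2 ^ d := by
  set V := ∑ l, a l ^ 2 with hV
  -- With `t = u² / V`, the indicator of `t ≤ θ` is at most `1 - 2 t / 3 + t² / 9 + 2 θ / 3`,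
  -- because `1 - 2 t / 3 + t² / 9 = (1 - t / 3)²`.
  have key (s : Fin d → Bool) : (if signSum a s ^ 2 ≤ θ * V then (1 : ℝ) else 0)
      ≤ 1 + 2 / 3 * θ - 2 / (3 * V) * signSum a s ^ 2 + 1 / (9 * V ^ 2) * signSum a s ^ 4 := by
    have e : 1 + 2 / 3 * θ - 2 / (3 * V) * signSum a s ^ 2 + 1 / (9 * V ^ 2) * signSum a s ^ 4
        = (1 - signSum a s ^ 2 / V / 3) ^ 2 + 2 / 3 * θ := by field_simp; ring
    rw [e]
    split_ifs with h
    · have h1 : signSum a s ^ 2 / V ≤ θ := (div_le_iff₀ ha).2 h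
      nlinarith [sq_nonneg (signSum a s ^ 2 / V)]
    · positivity
  refine (Finset.sum_le_sum fun s _ => key s).trans ?_
  simp only [Finset.sum_add_distrib, Finset.sum_sub_distrib, ← Finset.mul_sum, sum_signSum_sq,
    ← hV]
  have h4 : 1 / (9 * V ^ 2) * ∑ s, signSum a s ^ 4 ≤ 1 / (9 * V ^ 2) * (3 * 2 ^ d * V ^ 2) :=
    mul_le_mul_of_nonneg_left (sum_signSum_pow_four_le a) (by positivity)
  have h5 : 1 / (9 * V ^ 2) * (3 * 2 ^ d * V ^ 2) = 2 ^ d / 3 := by field_simp; norm_num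
  have h6 : 2 / (3 * V) * (2 ^ d * V) = 2 * 2 ^ d / 3 := by field_simp
  rw [h6]
  rw [h5] at h4
  simp only [Finset.sum_const, Finset.card_univ, Fintype.card_pi, Fintype.card_bool,
      Finset.prod_const, Fintype.card_fin, nsmul_eq_mul, Nat.cast_pow, Nat.cast_ofNat]
  linarith

/-! ### Leverage scores -/

/-- The leverage scores of a matrix with `m` rows: they sum to at most `m`, and they compare the
diagonal entries of the Gram matrix `Nᵀ N` with the norms of its columns. They are the squared
lengths of the projections of the standard basis to the row space. -/
theorem exists_leverage_scores {m d : ℕ} (N : Matrix (Fin m) (Fin d) ℝ) :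
    ∃ ℓ : Fin d → ℝ, (∀ k, 0 ≤ ℓ k) ∧ ∑ k, ℓ k ≤ m ∧
      ∀ k, (Nᵀ * N) k k ^ 2 ≤ ℓ k * ∑ l, (Nᵀ * N) k l ^ 2 := by
  let row : Fin m → EuclideanSpace ℝ (Fin d) := fun i => WithLp.toLp 2 (N i)
  let W := Submodule.span ℝ (Set.range row)
  let b := stdOrthonormalBasis ℝ W
  refine ⟨fun k => ∑ r, (b r : EuclideanSpace ℝ (Fin d)) k ^ 2,
    fun k => Finset.sum_nonneg fun r _ => sq_nonneg _, ?_, fun k => ?_⟩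
  · rw [Finset.sum_comm]
    have h (r) : ∑ k, (b r : EuclideanSpace ℝ (Fin d)) k ^ 2 = 1 := by
      have h1 : ‖(b r : EuclideanSpace ℝ (Fin d))‖ ^ 2 = 1 := by
        rw [Submodule.norm_coe, b.orthonormal.1 r]; norm_num
      rw [← h1, EuclideanSpace.real_norm_sq_eq]
    simp only [h]
    have : Module.finrank ℝ W ≤ m := by
      simpa [Set.finrank] using finrank_range_le_card (R := ℝ) row
    simpa using this
  · have hw : (∑ i, N i k • row i) ∈ W :=
      Submodule.sum_mem _ fun i _ => Submodule.smul_mem _ _ (Submodule.subset_span ⟨i, rfl⟩)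
    let w : W := ⟨∑ i, N i k • row i, hw⟩
    have hwl (l) : (w : EuclideanSpace ℝ (Fin d)) l = (Nᵀ * N) k l := by
      simp [w, row, Matrix.mul_apply]
    have hexp : (w : EuclideanSpace ℝ (Fin d)) k
        = ∑ r, (b r : EuclideanSpace ℝ (Fin d)) k * inner ℝ (b r) w := by
      conv_lhs => rw [← b.sum_repr' w]
      simp [mul_comm]
    have hnorm : ∑ r, inner ℝ (b r) w ^ 2 = ∑ l, (Nᵀ * N) k l ^ 2 := by
      have h1 := b.sum_sq_norm_inner_right w
      have h2 : ‖w‖ ^ 2 = ∑ l, (Nᵀ * N) k l ^ 2 := by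
        rw [← Submodule.norm_coe, EuclideanSpace.real_norm_sq_eq]
        simp only [hwl]
      rw [← h2, ← h1]
      simp
    rw [← hwl k, hexp, ← hnorm]
    exact Finset.sum_mul_sq_le_sq_mul_sq _ _ _

/-! ### Gram forms and sign vectors -/

/-- The bilinear form `xᵀ Nᵀ N y`. -/
def gramForm {m d : ℕ} (N : Matrix (Fin m) (Fin d) ℝ) (x y : Fin d → ℝ) : ℝ :=
  (N *ᵥ x) ⬝ᵥ (N *ᵥ y)

theorem gramForm_mul_orthogonal {m d : ℕ} (N : Matrix (Fin m) (Fin d) ℝ)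
    (O : Matrix (Fin d) (Fin d) ℝ) (x y : Fin d → ℝ) :
    gramForm (N * O) x y = gramForm N (O *ᵥ x) (O *ᵥ y) := by
  simp [gramForm, Matrix.mulVec_mulVec]

theorem gramForm_single_left {m d : ℕ} (N : Matrix (Fin m) (Fin d) ℝ) (k : Fin d)
    (y : Fin d → ℝ) :
    gramForm N (Pi.single k 1) y = ∑ l, (Nᵀ * N) k l * y l := by
  rw [gramForm, Matrix.mulVec_single_one]
  simp only [dotProduct, Matrix.mulVec, Matrix.mul_apply, Finset.sum_mul, Finset.mul_sum]
  rw [Finset.sum_comm]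
  simp [mul_assoc]

theorem gramForm_single_single {m d : ℕ} (N : Matrix (Fin m) (Fin d) ℝ) (k l : Fin d) :
    gramForm N (Pi.single k 1) (Pi.single l 1) = (Nᵀ * N) k l := by
  rw [gramForm_single_left, Finset.sum_eq_single l] <;> simp +contextual

/-- What a good sketch does to most pairs of orthonormal directions: it roughly preserves the
length of the first one, and it keeps the two nearly orthogonal. -/
def NearlyOrthonormal {m d : ℕ} (ε : ℝ) (N : Matrix (Fin m) (Fin d) ℝ) (x y : Fin d → ℝ) : Prop :=
  |gramForm N x x - 1| ≤ 1 / 2 ∧ |gramForm N x y| ≤ 4 * ε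

/-- The unit vector orthogonal to the `k`-th basis vector all of whose other coordinates are
`± 1 / √(d - 1)`, with the signs given by `s`. -/
noncomputable def signVector {d : ℕ} (k : Fin d) (s : Fin d → Bool) : Fin d → ℝ :=
  fun l => if l = k then 0 else boolSign (s l) / Real.sqrt (d - 1)

theorem signVector_dotProduct_self {d : ℕ} (hd : 2 ≤ d) (k : Fin d) (s : Fin d → Bool) :
    signVector k s ⬝ᵥ signVector k s = 1 := by
  have hd' : (2 : ℝ) ≤ d := by exact_mod_cast hd
  have h (l : Fin d) : signVector k s l * signVector k s l
      = 1 / (d - 1) - if l = k then 1 / ((d : ℝ) - 1) else 0 := by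
    unfold signVector
    split_ifs
    · simp
    · rw [div_mul_div_comm, Real.mul_self_sqrt (by linarith), ← sq, boolSign_sq, sub_zero]
  rw [dotProduct, Finset.sum_congr rfl fun l _ => h l, Finset.sum_sub_distrib]
  have : (d : ℝ) - 1 ≠ 0 := by linarith
  simp
  field_simp

theorem single_dotProduct_signVector {d : ℕ} (k : Fin d) (s : Fin d → Bool) :
    Pi.single k 1 ⬝ᵥ signVector k s = 0 := by
  simp [signVector]

theorem gramForm_single_signVector {m d : ℕ} (N : Matrix (Fin m) (Fin d) ℝ) (k : Fin d)
    (s : Fin d → Bool) :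
    gramForm N (Pi.single k 1) (signVector k s)
      = signSum (fun l => if l = k then 0 else (Nᵀ * N) k l) s / Real.sqrt (d - 1) := by
  rw [gramForm_single_left, signSum, Finset.sum_div]
  refine Finset.sum_congr rfl fun l _ => ?_
  unfold signVector
  split_ifs
  · simp
  · ring

open Classical in
/-- If the leverage score `ℓ` of the `k`-th coordinate is small then, for a definite fraction of the
signs, the sketch fails to keep the `k`-th basis vector and the sign vector nearly orthonormal. The
bound `101 / 150` is `2 / 3 + 2 / 3 * θ` at `θ = 1 / 100`. -/
theorem card_nearlyOrthonormal_signVector_le {m d : ℕ} (hd : 2 ≤ d) {ε : ℝ} (hε : 0 < ε)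
    (hdε : 1 ≤ d * ε ^ 2) (N : Matrix (Fin m) (Fin d) ℝ) (k : Fin d) {ℓ : ℝ}
    (hℓ : (Nᵀ * N) k k ^ 2 ≤ ℓ * ∑ l, (Nᵀ * N) k l ^ 2) (hsmall : ℓ * (d * ε ^ 2) ≤ 1 / 12800) :
    (∑ s, if NearlyOrthonormal ε N (Pi.single k 1) (signVector k s) then (1 : ℝ) else 0)
      ≤ 101 / 150 * 2 ^ d := by
  have hd' : (2 : ℝ) ≤ d := by exact_mod_cast hd
  by_cases hkk : |(Nᵀ * N) k k - 1| ≤ 1 / 2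
  swap
  · rw [Finset.sum_eq_zero]
    · positivity
    · intro s _
      rw [if_neg]
      intro h
      exact hkk (by simpa [gramForm_single_single] using h.1)
  set R := ∑ l, (Nᵀ * N) k l ^ 2 with hR
  have hR0 : 0 ≤ R := Finset.sum_nonneg fun l _ => sq_nonneg _
  have hq : 1 / 4 ≤ (Nᵀ * N) k k ^ 2 := by nlinarith [(abs_le.1 hkk).1]
  set a : Fin d → ℝ := fun l => if l = k then 0 else (Nᵀ * N) k l with ha
  have hsum : ∑ l, a l ^ 2 = R - (Nᵀ * N) k k ^ 2 := by
    have h (l : Fin d) : a l ^ 2 = (Nᵀ * N) k l ^ 2 - if l = k then (Nᵀ * N) k k ^ 2 else 0 := by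
      simp only [ha]; split_ifs with h <;> simp [h]
    simp [h, ← hR]
  -- the off-diagonal part of the row has squared length at least `R / 2 ≥ 1600 d ε²`, and
  -- `(4 ε)² (d - 1)` is at most `1 / 100` of that
  have hRd : 3200 * (d * ε ^ 2) ≤ R := by
    have h1 : 1 / 4 * (d * ε ^ 2) ≤ ℓ * R * (d * ε ^ 2) :=
      mul_le_mul_of_nonneg_right (hq.trans hℓ) (by positivity)
    nlinarith [mul_le_mul_of_nonneg_right hsmall hR0]
  have hhalf : (Nᵀ * N) k k ^ 2 ≤ R / 2 := by
    have h1 : (Nᵀ * N) k k ^ 2 * 1 ≤ (Nᵀ * N) k k ^ 2 * (d * ε ^ 2) :=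
      mul_le_mul_of_nonneg_left hdε (sq_nonneg _)
    have h2 : (Nᵀ * N) k k ^ 2 * (d * ε ^ 2) ≤ ℓ * R * (d * ε ^ 2) :=
      mul_le_mul_of_nonneg_right hℓ (by positivity)
    nlinarith [mul_le_mul_of_nonneg_right hsmall hR0]
  have hpos : 0 < ∑ l, a l ^ 2 := by rw [hsum]; linarith
  have hcard := card_signSum_sq_le a hpos (θ := 1 / 100) (by norm_num)
  refine le_trans (Finset.sum_le_sum fun s _ => ?_) (hcard.trans (le_of_eq (by norm_num)))
  split_ifs with h1 h2 h2 <;> try norm_num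
  refine h2 ?_
  have h3 := h1.2
  rw [gramForm_single_signVector, abs_div, abs_of_nonneg (Real.sqrt_nonneg _),
    div_le_iff₀ (Real.sqrt_pos.2 (by linarith))] at h3
  have h4 := pow_le_pow_left₀ (abs_nonneg _) h3 2
  rw [sq_abs, mul_pow, Real.sq_sqrt (by linarith)] at h4
  rw [hsum]
  nlinarith [sq_nonneg ε]

open Classical in
/-- Averaged over the coordinates `k`: since the leverage scores sum to at most `m`, all but one
coordinate in a hundred have a small one; `41 / 60 = 101 / 150 + 1 / 100`. -/
theorem sum_card_nearlyOrthonormal_signVector_le {m d : ℕ} (hd : 2 ≤ d) {ε : ℝ} (hε : 0 < ε)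
    (hdε : 1 ≤ d * ε ^ 2) (hm : m * ε ^ 2 ≤ 1 / 1280000) (N : Matrix (Fin m) (Fin d) ℝ) :
    (∑ k, ∑ s, if NearlyOrthonormal ε N (Pi.single k 1) (signVector k s) then (1 : ℝ) else 0)
      ≤ 41 / 60 * (d * 2 ^ d) := by
  obtain ⟨ℓ, hℓ0, hℓm, hℓ⟩ := exists_leverage_scores N
  have key (k : Fin d) :
      (∑ s, if NearlyOrthonormal ε N (Pi.single k 1) (signVector k s) then (1 : ℝ) else 0)
        ≤ (101 / 150 + 12800 * (ℓ k * (d * ε ^ 2))) * 2 ^ d := by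
    have h0 : 0 ≤ ℓ k * (d * ε ^ 2) := mul_nonneg (hℓ0 k) (by positivity)
    -- a coordinate whose score is not small is charged to the second summand
    by_cases hs : ℓ k * (d * ε ^ 2) ≤ 1 / 12800
    · exact (card_nearlyOrthonormal_signVector_le hd hε hdε N k (hℓ k) hs).trans
        (mul_le_mul_of_nonneg_right (by linarith) (by positivity))
    · calc (∑ s, if NearlyOrthonormal ε N (Pi.single k 1) (signVector k s) then (1 : ℝ) else 0)
          ≤ ∑ _s : Fin d → Bool, (1 : ℝ) :=
            Finset.sum_le_sum fun s _ => by split_ifs <;> norm_num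
        _ = 1 * 2 ^ d := by simp
        _ ≤ _ := mul_le_mul_of_nonneg_right (by linarith) (by positivity)
  refine (Finset.sum_le_sum fun k _ => key k).trans ?_
  rw [← Finset.sum_mul, Finset.sum_add_distrib, ← Finset.mul_sum, ← Finset.sum_mul]
  have h1 : (∑ k, ℓ k) * (d * ε ^ 2) ≤ d * (1 / 1280000) := by
    calc (∑ k, ℓ k) * (d * ε ^ 2) ≤ m * (d * ε ^ 2) :=
          mul_le_mul_of_nonneg_right hℓm (by positivity)
      _ = d * (m * ε ^ 2) := by ring
      _ ≤ d * (1 / 1280000) := mul_le_mul_of_nonneg_left hm (by positivity)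
  simp only [Finset.sum_const, Finset.card_univ, Fintype.card_fin, nsmul_eq_mul]
  rw [show (41 / 60 * (d * 2 ^ d) : ℝ) = 41 / 60 * d * 2 ^ d by ring]
  exact mul_le_mul_of_nonneg_right (by linarith) (by positivity)

/-! ### Haar measure on the orthogonal group -/

instance haarOrthogonal_isMulRightInvariant (d : ℕ) :
    (haarOrthogonal d).IsMulRightInvariant where
  map_mul_right_eq_self O := by
    have : IsProbabilityMeasure (Measure.map (· * O) (haarOrthogonal d)) :=
      Measure.isProbabilityMeasure_map (measurable_mul_const O).aemeasurable
    exact Measure.isHaarMeasure_eq_of_isProbabilityMeasure _ _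

theorem exists_orthogonal_mulVec_single {d : ℕ} {i j : Fin d} (hij : i ≠ j) {x y : Fin d → ℝ}
    (hx : x ⬝ᵥ x = 1) (hy : y ⬝ᵥ y = 1) (hxy : x ⬝ᵥ y = 0) :
    ∃ O : Matrix.orthogonalGroup (Fin d) ℝ,
      (O : Matrix (Fin d) (Fin d) ℝ) *ᵥ Pi.single i 1 = x ∧
      (O : Matrix (Fin d) (Fin d) ℝ) *ᵥ Pi.single j 1 = y := by
  classical
  let v : Fin d → EuclideanSpace ℝ (Fin d) :=
    fun l => if l = i then WithLp.toLp 2 x else WithLp.toLp 2 y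
  have hv : Orthonormal ℝ (({i, j} : Set (Fin d)).domRestrict v) := by
    rw [orthonormal_iff_ite]
    rintro ⟨a, ha⟩ ⟨b, hb⟩
    have hyx : y ⬝ᵥ x = 0 := by rw [dotProduct_comm, hxy]
    have hnorm {z : Fin d → ℝ} (hz : z ⬝ᵥ z = 1) : ‖WithLp.toLp 2 z‖ = 1 := by
      rw [← sq_eq_sq₀ (norm_nonneg _) zero_le_one, EuclideanSpace.real_norm_sq_eq]
      simpa [dotProduct, sq] using hz
    rcases ha with rfl | ha <;> rcases hb with rfl | hb
    · simp [v, hnorm hx]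
    · obtain rfl : b = j := hb
      simp [v, EuclideanSpace.inner_toLp_toLp, hij.symm, hyx]
      exact fun h => hij (congrArg Subtype.val h)
    · obtain rfl : a = j := ha
      simp [v, EuclideanSpace.inner_toLp_toLp, hij.symm, hxy]
      exact fun h => hij (congrArg Subtype.val h).symm
    · obtain rfl : a = j := ha
      obtain rfl : b = a := hb
      simp [v, hij.symm, hnorm hy]
  obtain ⟨b, hb⟩ := hv.exists_orthonormalBasis_extension_of_card_eq (by simp)
  have hO : (Matrix.of fun r c => b c r) ∈ Matrix.orthogonalGroup (Fin d) ℝ := by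
    rw [Matrix.mem_orthogonalGroup_iff']
    ext k l
    have h := orthonormal_iff_ite.1 b.orthonormal k l
    rw [PiLp.inner_apply] at h
    simpa [Matrix.mul_apply, Matrix.one_apply, Matrix.star_apply, mul_comm] using h
  refine ⟨⟨_, hO⟩, ?_, ?_⟩
  · ext r
    simp [hb i (by simp), v]
  · ext r
    simp [hb j (by simp), v, hij.symm]

/-- The right invariance of Haar measure, in the form used below: the joint law of the images under
`S Q` of a pair of orthonormal vectors does not depend on the pair. -/
theorem haarOrthogonal_gramForm_eq {m d : ℕ} (S : Matrix (Fin m) (Fin d) ℝ) {i j : Fin d}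
    (hij : i ≠ j) {x y : Fin d → ℝ} (hx : x ⬝ᵥ x = 1) (hy : y ⬝ᵥ y = 1) (hxy : x ⬝ᵥ y = 0)
    (p : ℝ → ℝ → Prop) :
    (haarOrthogonal d).real {Q | p (gramForm (S * Q.1) x x) (gramForm (S * Q.1) x y)}
      = (haarOrthogonal d).real {Q | p (gramForm (S * Q.1) (Pi.single i 1) (Pi.single i 1))
          (gramForm (S * Q.1) (Pi.single i 1) (Pi.single j 1))} := by
  obtain ⟨O, hOi, hOj⟩ := exists_orthogonal_mulVec_single hij hx hy hxy
  rw [measureReal_def, measureReal_def, ← measure_preimage_mul_right (haarOrthogonal d) O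
    {Q | p (gramForm (S * Q.1) (Pi.single i 1) (Pi.single i 1))
          (gramForm (S * Q.1) (Pi.single i 1) (Pi.single j 1))}]
  simp only [Set.preimage_ofPred_eq, Submonoid.coe_mul, ← Matrix.mul_assoc,
    gramForm_mul_orthogonal _ O.1, hOi, hOj]

theorem continuous_gramForm_mul {m d : ℕ} (S : Matrix (Fin m) (Fin d) ℝ) (x y : Fin d → ℝ) :
    Continuous fun Q : Matrix.orthogonalGroup (Fin d) ℝ => gramForm (S * Q.1) x y := by
  have h (z : Fin d → ℝ) :
      Continuous fun Q : Matrix.orthogonalGroup (Fin d) ℝ => (S * Q.1) *ᵥ z :=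
    (continuous_const.matrix_mul continuous_subtype_val).matrix_mulVec continuous_const
  exact (h x).dotProduct (h y)

theorem measurableSet_nearlyOrthonormal {m d : ℕ} (ε : ℝ) (S : Matrix (Fin m) (Fin d) ℝ)
    (x y : Fin d → ℝ) :
    MeasurableSet {Q : Matrix.orthogonalGroup (Fin d) ℝ | NearlyOrthonormal ε (S * Q.1) x y} := by
  have h1 := continuous_gramForm_mul S x x
  have h2 := continuous_gramForm_mul S x y
  exact ((isClosed_le (h1.sub continuous_const).abs continuous_const).inter
    (isClosed_le h2.abs continuous_const)).measurableSet

open Classical in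
/-- If no point lies in more than `C` of the events, counted with multiplicity, then their
probabilities sum to at most `C`. -/
theorem sum_measureReal_le_of_sum_indicator_le {Ω ι : Type*} [MeasurableSpace Ω] (P : Measure Ω)
    [IsProbabilityMeasure P] (t : Finset ι) (A : ι → Set Ω) (hA : ∀ i ∈ t, MeasurableSet (A i))
    (C : ℝ) (h : ∀ ω, (∑ i ∈ t, if ω ∈ A i then (1 : ℝ) else 0) ≤ C) :
    ∑ i ∈ t, P.real (A i) ≤ C := by
  have h1 (i) (hi : i ∈ t) : P.real (A i) = ∫ ω, (A i).indicator 1 ω ∂P :=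
    (integral_indicator_one (hA i hi)).symm
  have hint (i) (hi : i ∈ t) : Integrable ((A i).indicator (1 : Ω → ℝ)) P :=
    (integrable_const (1 : ℝ)).indicator (hA i hi)
  rw [Finset.sum_congr rfl h1, ← integral_finsetSum _ hint]
  calc ∫ ω, ∑ i ∈ t, (A i).indicator 1 ω ∂P ≤ ∫ _ω, C ∂P := by
        refine integral_mono (integrable_finsetSum _ hint) (integrable_const C) fun ω => ?_
        simpa [Set.indicator_apply] using h ω
    _ = C := by simp

/-- For a fixed sketch with too few rows, two columns of a random orthogonal matrix are mapped to a
nearly orthonormal pair with probability at most `41 / 60`: conditionally on the orthogonal matrix,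
the pair can be replaced by a random basis vector and a random sign vector. -/
theorem haarOrthogonal_nearlyOrthonormal_le {m d : ℕ} {ε : ℝ} (hε : 0 < ε)
    (hdε : 1 ≤ d * ε ^ 2) (hm : m * ε ^ 2 ≤ 1 / 1280000) (S : Matrix (Fin m) (Fin d) ℝ)
    {i j : Fin d} (hij : i ≠ j) :
    (haarOrthogonal d).real {Q | NearlyOrthonormal ε (S * Q.1) (Pi.single i 1) (Pi.single j 1)}
      ≤ 41 / 60 := by
  classical
  have hd : 2 ≤ d := by
    have h1 := i.2
    have h2 := j.2
    have h3 : (i : ℕ) ≠ j := fun h => hij (Fin.ext h)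
    omega
  have h := sum_measureReal_le_of_sum_indicator_le (haarOrthogonal d)
    (Finset.univ : Finset (Fin d × (Fin d → Bool)))
    (fun ks => {Q | NearlyOrthonormal ε (S * Q.1) (Pi.single ks.1 1) (signVector ks.1 ks.2)})
    (fun ks _ => measurableSet_nearlyOrthonormal _ _ _ _) (41 / 60 * (d * 2 ^ d)) fun Q => by
      rw [Fintype.sum_prod_type]
      exact sum_card_nearlyOrthonormal_signVector_le hd hε hdε hm (S * Q.1)
  have heq (ks : Fin d × (Fin d → Bool)) : (haarOrthogonal d).real
      {Q | NearlyOrthonormal ε (S * Q.1) (Pi.single ks.1 1) (signVector ks.1 ks.2)}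
      = (haarOrthogonal d).real
        {Q | NearlyOrthonormal ε (S * Q.1) (Pi.single i 1) (Pi.single j 1)} :=
    haarOrthogonal_gramForm_eq S hij (by simp) (signVector_dotProduct_self hd ks.1 ks.2)
      (single_dotProduct_signVector ks.1 ks.2) fun u v => |u - 1| ≤ 1 / 2 ∧ |v| ≤ 4 * ε
  simp only [heq] at h
  have hpos : (0 : ℝ) < d * 2 ^ d := by
    have : 0 < d := by omega
    positivity
  simp only [Finset.sum_const, Finset.card_univ, Fintype.card_prod, Fintype.card_fin,
    Fintype.card_pi, Fintype.card_bool, Finset.prod_const, nsmul_eq_mul, Nat.cast_mul,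
    Nat.cast_pow, Nat.cast_ofNat] at h
  rw [mul_comm] at h
  exact le_of_mul_le_mul_right h hpos

/-- The case of a single column: if the sketch roughly preserves the norms of `x` and of the
orthonormal pair `(x ± y) / √2` then it keeps `x` and `y` nearly orthonormal, by polarization. -/
theorem haarOrthogonal_abs_gramForm_sub_one_le {m d : ℕ} {ε : ℝ} (hε : 0 < ε) (hε' : ε ≤ 1 / 2)
    (hdε : 1 ≤ d * ε ^ 2) (hm : m * ε ^ 2 ≤ 1 / 1280000) (S : Matrix (Fin m) (Fin d) ℝ)
    {i j : Fin d} (hij : i ≠ j) :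
    (haarOrthogonal d).real {Q | |gramForm (S * Q.1) (Pi.single i 1) (Pi.single i 1) - 1| ≤ ε}
      ≤ 161 / 180 := by
  set E : (Fin d → ℝ) → Set (Matrix.orthogonalGroup (Fin d) ℝ) :=
    fun x => {Q | |gramForm (S * Q.1) x x - 1| ≤ ε}
  have hEm (x) : MeasurableSet (E x) :=
    (isClosed_le ((continuous_gramForm_mul S x x).sub continuous_const).abs
      continuous_const).measurableSet
  set e : Fin d → ℝ := Pi.single i 1 with he
  set f : Fin d → ℝ := Pi.single j 1 with hf
  have hee : e ⬝ᵥ e = 1 := by simp [he]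
  have hff : f ⬝ᵥ f = 1 := by simp [hf]
  have hef : e ⬝ᵥ f = 0 := by simp [he, hf, hij]
  have hfe : f ⬝ᵥ e = 0 := by rw [dotProduct_comm, hef]
  set r : ℝ := (Real.sqrt 2)⁻¹ with hr
  have hrr : r * r = 1 / 2 := by
    rw [hr, ← mul_inv, Real.mul_self_sqrt (by norm_num)]; norm_num
  set u := r • (e + f) with hu
  set v := r • (e - f) with hv
  have huu : u ⬝ᵥ u = 1 := by
    simp only [hu, smul_dotProduct, dotProduct_smul, add_dotProduct, dotProduct_add, hee, hff, hef,
      hfe, smul_eq_mul]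
    linarith
  have hvv : v ⬝ᵥ v = 1 := by
    simp only [hv, smul_dotProduct, dotProduct_smul, sub_dotProduct, dotProduct_sub, hee, hff, hef,
      hfe, smul_eq_mul]
    linarith
  have huv : u ⬝ᵥ v = 0 := by
    simp only [hu, hv, smul_dotProduct, dotProduct_smul, add_dotProduct, dotProduct_sub, hee, hff,
      hef, hfe, smul_eq_mul]
    ring
  have hEu : (haarOrthogonal d).real (E u) = (haarOrthogonal d).real (E e) :=
    haarOrthogonal_gramForm_eq S hij huu hvv huv fun s _ => |s - 1| ≤ ε
  have hEv : (haarOrthogonal d).real (E v) = (haarOrthogonal d).real (E e) :=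
    haarOrthogonal_gramForm_eq S hij hvv huu (by rw [dotProduct_comm, huv]) fun s _ => |s - 1| ≤ ε
  have hsub : {Q : Matrix.orthogonalGroup (Fin d) ℝ | NearlyOrthonormal ε (S * Q.1) e f}ᶜ
      ⊆ (E e)ᶜ ∪ ((E u)ᶜ ∪ (E v)ᶜ) := by
    intro Q hQ
    by_contra hc
    simp only [Set.mem_union, Set.mem_compl_iff, not_or, not_not] at hc
    obtain ⟨h1, h2, h3⟩ := hc
    refine hQ ⟨le_trans h1 hε', ?_⟩
    -- the form takes the values `(g e e + g f f) / 2 ± g e f` at `u` and `v`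
    have hpol : gramForm (S * Q.1) u u - gramForm (S * Q.1) v v = 2 * gramForm (S * Q.1) e f := by
      simp only [gramForm, hu, hv, Matrix.mulVec_smul, Matrix.mulVec_add, Matrix.mulVec_sub,
        smul_dotProduct, dotProduct_smul, add_dotProduct, dotProduct_add, sub_dotProduct,
        dotProduct_sub, smul_eq_mul]
      rw [dotProduct_comm ((S * Q.1) *ᵥ f) ((S * Q.1) *ᵥ e)]
      linear_combination (4 * ((S * Q.1) *ᵥ e) ⬝ᵥ ((S * Q.1) *ᵥ f)) * hrr
    have h2' : _ ∧ _ := abs_le.1 (show |gramForm (S * Q.1) u u - 1| ≤ ε from h2)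
    have h3' : _ ∧ _ := abs_le.1 (show |gramForm (S * Q.1) v v - 1| ≤ ε from h3)
    rw [abs_le]
    constructor <;> linarith [h2'.1, h2'.2, h3'.1, h3'.2]
  have hle := (measureReal_mono (μ := haarOrthogonal d) hsub).trans
    ((measureReal_union_le _ _).trans (add_le_add_right (measureReal_union_le _ _) _))
  rw [probReal_compl_eq_one_sub (hEm _), probReal_compl_eq_one_sub (hEm _),
    probReal_compl_eq_one_sub (hEm _), hEu, hEv,
    probReal_compl_eq_one_sub (measurableSet_nearlyOrthonormal _ _ _ _)] at hle
  have hgood := haarOrthogonal_nearlyOrthonormal_le hε hdε hm S hij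
  linarith

/-! ### Random matrices with orthonormal columns -/

open Classical in
/-- If `X` is within `ε n` of the identity in Frobenius norm then, for all but a `41 / 200` fraction
of the pairs `i ≠ j`, the entry `X i i` is close to `1` and `X i j` is `O(ε)`. -/
theorem card_bad_pairs_le {n : ℕ} (hn : 2 ≤ n) {ε : ℝ} (hε : 0 < ε) (hεn : ε ^ 2 * n ≤ 1 / 100)
    (X : Fin n → Fin n → ℝ)
    (hX : ∑ i, ∑ j, (X i j - if i = j then 1 else 0) ^ 2 ≤ (ε * n) ^ 2) :
    (∑ p ∈ (Finset.univ : Finset (Fin n)).offDiag,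
      if |X p.1 p.1 - 1| ≤ 1 / 2 ∧ |X p.1 p.2| ≤ 4 * ε then (0 : ℝ) else 1)
      ≤ 41 / 200 * (n * n - n) := by
  have hn' : (2 : ℝ) ≤ n := by exact_mod_cast hn
  -- Markov's inequality, entry by entry
  have hpt (p : Fin n × Fin n) :
      (if |X p.1 p.1 - 1| ≤ 1 / 2 ∧ |X p.1 p.2| ≤ 4 * ε then (0 : ℝ) else 1)
        ≤ 4 * (X p.1 p.1 - 1) ^ 2 + 1 / (16 * ε ^ 2) * X p.1 p.2 ^ 2 := by
    split_ifs with h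
    · positivity
    rw [not_and_or, not_le, not_le] at h
    rcases h with h | h
    · have h1 : 0 ≤ 1 / (16 * ε ^ 2) * X p.1 p.2 ^ 2 := by positivity
      have h2 := sq_abs (X p.1 p.1 - 1)
      nlinarith
    · have h1 : (4 * ε) ^ 2 ≤ X p.1 p.2 ^ 2 := by
        rw [← sq_abs (X p.1 p.2)]
        exact pow_le_pow_left₀ (by positivity) h.le 2
      have h2 : 1 ≤ 1 / (16 * ε ^ 2) * X p.1 p.2 ^ 2 := by
        rw [one_div_mul_eq_div, le_div_iff₀ (by positivity)]
        linarith
      nlinarith [sq_nonneg (X p.1 p.1 - 1)]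
  set F := ∑ i, ∑ j, (X i j - if i = j then 1 else 0) ^ 2 with hF
  have hdiag : ∑ p ∈ (Finset.univ : Finset (Fin n)).offDiag, (X p.1 p.1 - 1) ^ 2 ≤ n * F := by
    calc ∑ p ∈ (Finset.univ : Finset (Fin n)).offDiag, (X p.1 p.1 - 1) ^ 2
        ≤ ∑ p : Fin n × Fin n, (X p.1 p.1 - 1) ^ 2 :=
          Finset.sum_le_univ_sum_of_nonneg fun p => sq_nonneg _
      _ = n * ∑ i, (X i i - 1) ^ 2 := by
          rw [Fintype.sum_prod_type]
          simp [Finset.mul_sum]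
      _ ≤ n * F := by
          refine mul_le_mul_of_nonneg_left (Finset.sum_le_sum fun i _ => ?_) (by positivity)
          have h := Finset.single_le_sum (f := fun j => (X i j - if i = j then 1 else 0) ^ 2)
            (fun j _ => sq_nonneg _) (Finset.mem_univ i)
          simpa using h
  have hoff : ∑ p ∈ (Finset.univ : Finset (Fin n)).offDiag, X p.1 p.2 ^ 2 ≤ F := by
    calc ∑ p ∈ (Finset.univ : Finset (Fin n)).offDiag, X p.1 p.2 ^ 2
        = ∑ p ∈ (Finset.univ : Finset (Fin n)).offDiag,
            (X p.1 p.2 - if p.1 = p.2 then 1 else 0) ^ 2 :=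
          Finset.sum_congr rfl fun p hp => by simp [(Finset.mem_offDiag.1 hp).2.2]
      _ ≤ ∑ p : Fin n × Fin n, (X p.1 p.2 - if p.1 = p.2 then 1 else 0) ^ 2 :=
          Finset.sum_le_univ_sum_of_nonneg fun p => sq_nonneg _
      _ = F := Fintype.sum_prod_type _
  refine (Finset.sum_le_sum fun p _ => hpt p).trans ?_
  rw [Finset.sum_add_distrib, ← Finset.mul_sum, ← Finset.mul_sum]
  have h1 : 1 / (16 * ε ^ 2) * ∑ p ∈ (Finset.univ : Finset (Fin n)).offDiag, X p.1 p.2 ^ 2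
      ≤ 1 / (16 * ε ^ 2) * (ε * n) ^ 2 :=
    mul_le_mul_of_nonneg_left (hoff.trans hX) (by positivity)
  have h2 : 1 / (16 * ε ^ 2) * (ε * n) ^ 2 = n * n / 16 := by field_simp
  have h3 : n * F ≤ n * n * (1 / 100) := by
    calc (n : ℝ) * F ≤ n * (ε * n) ^ 2 := mul_le_mul_of_nonneg_left hX (by positivity)
      _ = n * n * (ε ^ 2 * n) := by ring
      _ ≤ n * n * (1 / 100) := mul_le_mul_of_nonneg_left hεn (by positivity)
  nlinarith

theorem frobNorm_sub_one_le_iff {n : ℕ} (M : Matrix (Fin n) (Fin n) ℝ) {r : ℝ} (hr : 0 ≤ r) :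
    frobNorm (M - 1) ≤ r ↔ ∑ i, ∑ j, (M i j - if i = j then 1 else 0) ^ 2 ≤ r ^ 2 := by
  rw [frobNorm, Real.sqrt_le_left hr]
  simp [Matrix.one_apply]

theorem gram_firstColumns_apply {m d n : ℕ} (hnd : n ≤ d) (S : Matrix (Fin m) (Fin d) ℝ)
    (Q : Matrix (Fin d) (Fin d) ℝ) (i j : Fin n) :
    ((firstColumns n Q)ᵀ * Sᵀ * S * firstColumns n Q) i j
      = gramForm (S * Q) (Pi.single (Fin.castLE hnd i) 1) (Pi.single (Fin.castLE hnd j) 1) := by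
  have h (j : Fin n) : (S * firstColumns n Q).col j = (S * Q).col (Fin.castLE hnd j) := by
    ext r
    simp [Matrix.mul_apply, firstColumns, j.2.trans_le hnd, Fin.castLE]
  rw [Matrix.mul_assoc, ← Matrix.transpose_mul, gramForm, Matrix.mulVec_single_one,
    Matrix.mulVec_single_one, ← h, ← h]
  rfl

theorem continuous_frobNorm {p q : ℕ} :
    Continuous (frobNorm : Matrix (Fin p) (Fin q) ℝ → ℝ) := by
  unfold frobNorm
  fun_prop

theorem measurableSet_frobNorm_gram_sub_one_le (m d n : ℕ) (r : ℝ) :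
    MeasurableSet {p : Matrix (Fin d) (Fin n) ℝ × Matrix (Fin m) (Fin d) ℝ |
      frobNorm (p.1ᵀ * p.2ᵀ * p.2 * p.1 - 1) ≤ r} := by
  have : SecondCountableTopology (Matrix (Fin m) (Fin d) ℝ) :=
    inferInstanceAs (SecondCountableTopology (Fin m → Fin d → ℝ))
  refine (isClosed_le (continuous_frobNorm.comp ?_) continuous_const).measurableSet
  fun_prop

/-- A fixed sketch with too few rows fails on a random matrix with orthonormal columns with
probability at least `19 / 180 > 1 / 10`. -/
theorem uniformOrthonormal_frobNorm_le {m d n : ℕ} (hn : 1 ≤ n) (hnd : n ≤ d) {ε : ℝ} (hε : 0 < ε)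
    (hεn : ε ^ 2 * n ≤ 1 / 100) (hdε : 1 ≤ d * ε ^ 2) (hm : m * ε ^ 2 ≤ 1 / 1280000)
    (S : Matrix (Fin m) (Fin d) ℝ) :
    (uniformOrthonormal d n).real {A | frobNorm (Aᵀ * Sᵀ * S * A - 1) ≤ ε * n} ≤ 161 / 180 := by
  classical
  have hmeas : MeasurableSet {A : Matrix (Fin d) (Fin n) ℝ |
      frobNorm (Aᵀ * Sᵀ * S * A - 1) ≤ ε * n} :=
    measurable_prodMk_right (y := S) (measurableSet_frobNorm_gram_sub_one_le m d n (ε * n))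
  rw [uniformOrthonormal, map_measureReal_apply (measurable_firstColumns_coe d n) hmeas]
  set E := (fun Q : Matrix.orthogonalGroup (Fin d) ℝ => firstColumns n Q.1) ⁻¹'
    {A : Matrix (Fin d) (Fin n) ℝ | frobNorm (Aᵀ * Sᵀ * S * A - 1) ≤ ε * n}
  have hEm : MeasurableSet E := measurable_firstColumns_coe d n hmeas
  have hentries (Q) (hQ : Q ∈ E) : ∑ i : Fin n, ∑ j : Fin n,
      (gramForm (S * Q.1) (Pi.single (Fin.castLE hnd i) 1) (Pi.single (Fin.castLE hnd j) 1)
        - if i = j then 1 else 0) ^ 2 ≤ (ε * n) ^ 2 := by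
    have h := (frobNorm_sub_one_le_iff _ (by positivity)).1 (show frobNorm _ ≤ _ from hQ)
    simpa only [gram_firstColumns_apply hnd] using h
  have hn1 : (1 : ℝ) ≤ n := by exact_mod_cast hn
  have hε' : ε ^ 2 ≤ 1 / 100 := by nlinarith [sq_nonneg ε]
  rcases hn.eq_or_lt with rfl | hn2
  · have hd : 1 < d := by
      by_contra hd
      have : (d : ℝ) ≤ 1 := by exact_mod_cast not_lt.1 hd
      nlinarith [sq_nonneg ε]
    have hij : Fin.castLE hnd 0 ≠ ⟨1, hd⟩ := by simp [Fin.ext_iff]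
    refine le_trans (measureReal_mono fun Q hQ => ?_)
      (haarOrthogonal_abs_gramForm_sub_one_le hε (by nlinarith) hdε hm S hij)
    have h := hentries Q hQ
    simp only [Finset.univ_unique, Finset.sum_singleton, if_true, Nat.cast_one, mul_one] at h
    exact abs_le_of_sq_le_sq h hε.le
  · set G : Fin n × Fin n → Set (Matrix.orthogonalGroup (Fin d) ℝ) := fun p =>
      {Q | NearlyOrthonormal ε (S * Q.1) (Pi.single (Fin.castLE hnd p.1) 1)
        (Pi.single (Fin.castLE hnd p.2) 1)}
    have hGm (p) : MeasurableSet (G p) := measurableSet_nearlyOrthonormal _ _ _ _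
    have hn2' : (2 : ℝ) ≤ n := by exact_mod_cast hn2
    have hpos : (0 : ℝ) < n * n - n := by nlinarith
    have hbad := sum_measureReal_le_of_sum_indicator_le (haarOrthogonal d)
      (Finset.univ : Finset (Fin n)).offDiag (fun p => E \ G p)
      (fun p _ => hEm.diff (hGm p)) (41 / 200 * (n * n - n)) fun Q => by
        by_cases hQ : Q ∈ E
        · refine le_trans (le_of_eq (Finset.sum_congr rfl fun p _ => ?_))
            (card_bad_pairs_le hn2 hε hεn _ (hentries Q hQ))
          by_cases hp : Q ∈ G p
          · rw [if_neg fun h => h.2 hp]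
            exact (if_pos hp).symm
          · rw [if_pos ⟨hQ, hp⟩]
            exact (if_neg hp).symm
        · simpa [hQ] using hpos.le
    have hsplit (p) (hp : p ∈ (Finset.univ : Finset (Fin n)).offDiag) :
        (haarOrthogonal d).real E ≤ (haarOrthogonal d).real (E \ G p) + 41 / 60 := by
      have hne : Fin.castLE hnd p.1 ≠ Fin.castLE hnd p.2 := fun h =>
        (Finset.mem_offDiag.1 hp).2.2 (Fin.castLE_injective hnd h)
      have hgood : (haarOrthogonal d).real (G p) ≤ 41 / 60 :=
        haarOrthogonal_nearlyOrthonormal_le hε hdε hm S hne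
      have hsub : E ⊆ (E \ G p) ∪ G p := by simp
      linarith [(measureReal_mono (μ := haarOrthogonal d) hsub).trans (measureReal_union_le _ _)]
    have hsum := Finset.sum_le_sum hsplit
    rw [Finset.sum_add_distrib] at hsum
    have hcard : ((Finset.univ : Finset (Fin n)).offDiag.card : ℝ) = n * n - n := by
      rw [Finset.offDiag_card, Nat.cast_sub (by simpa using Nat.le_mul_self n)]
      simp
    simp only [Finset.sum_const, nsmul_eq_mul, hcard] at hsum
    have h : (n * n - n) * (haarOrthogonal d).real E ≤ (n * n - n) * (161 / 180 : ℝ) := by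
      linarith
    exact le_of_mul_le_mul_left h hpos

/-- The lower bound under the guarantee for a random matrix with orthonormal columns. -/
theorem le_rows_of_random_orthonormal {n : ℕ} {ε : ℝ} (hn : 1 ≤ n) (hε : 0 < ε)
    (hεn : ε ≤ 1 / 10 / Real.sqrt n) {d : ℕ} (hd : 1 * n / ε ^ 2 ≤ d) {m : ℕ}
    (μ : Measure (Matrix (Fin m) (Fin d) ℝ)) [IsProbabilityMeasure μ]
    (h : 9 / 10 ≤ ((uniformOrthonormal d n).prod μ).real
      {p | frobNorm (p.1ᵀ * p.2ᵀ * p.2 * p.1 - 1) ≤ ε * n}) :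
    1 / 1280000 / ε ^ 2 ≤ m := by
  by_contra! hm
  have hn1 : (1 : ℝ) ≤ n := by exact_mod_cast hn
  have hε2 : 0 < ε ^ 2 := by positivity
  rw [div_le_iff₀ hε2] at hd
  rw [lt_div_iff₀ hε2] at hm
  have hεn2 : ε ^ 2 * n ≤ 1 / 100 := by
    rw [le_div_iff₀ (Real.sqrt_pos.2 (by linarith))] at hεn
    have h1 := pow_le_pow_left₀ (by positivity) hεn 2
    rw [mul_pow, Real.sq_sqrt (by linarith)] at h1
    linarith
  have hnd : n ≤ d := by
    have : (n : ℝ) ≤ d := by nlinarith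
    exact_mod_cast this
  have hmeas := measurableSet_frobNorm_gram_sub_one_le m d n (ε * n)
  have hle : ((uniformOrthonormal d n).prod μ)
      {p | frobNorm (p.1ᵀ * p.2ᵀ * p.2 * p.1 - 1) ≤ ε * n} ≤ ENNReal.ofReal (161 / 180) := by
    rw [Measure.prod_apply_symm hmeas]
    calc _ ≤ ∫⁻ _S : Matrix (Fin m) (Fin d) ℝ, ENNReal.ofReal (161 / 180) ∂μ := by
          refine lintegral_mono fun S => ?_
          rw [← ENNReal.ofReal_toReal (measure_ne_top (uniformOrthonormal d n) _)]
          exact ENNReal.ofReal_le_ofReal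
            (uniformOrthonormal_frobNorm_le hn hnd hε hεn2 (by linarith) hm.le S)
      _ = ENNReal.ofReal (161 / 180) := by simp
  have := ENNReal.toReal_le_of_le_ofReal (by norm_num) hle
  rw [measureReal_def] at h
  linarith

/-! ### The guarantee for every fixed matrix -/

theorem transpose_mul_firstColumns {d n : ℕ} (hnd : n ≤ d)
    (Q : Matrix.orthogonalGroup (Fin d) ℝ) :
    (firstColumns n Q.1)ᵀ * firstColumns n Q.1 = 1 := by
  ext i j
  have h := congrFun (congrFun ((Matrix.mem_orthogonalGroup_iff' _ _).1 Q.2) (Fin.castLE hnd i))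
    (Fin.castLE hnd j)
  simpa [Matrix.mul_apply, Matrix.one_apply, Matrix.star_apply, firstColumns, i.2.trans_le hnd,
    j.2.trans_le hnd, Fin.ext_iff, Fin.castLE] using h

theorem frobNorm_eq_sqrt_trace {p q : ℕ} (A : Matrix (Fin p) (Fin q) ℝ) :
    frobNorm A = Real.sqrt (Aᵀ * A).trace := by
  rw [frobNorm, Finset.sum_comm]
  simp [Matrix.trace, Matrix.mul_apply, sq]

theorem frobNorm_mul_self {p q : ℕ} (A : Matrix (Fin p) (Fin q) ℝ) :
    frobNorm A * frobNorm A = (Aᵀ * A).trace := by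
  have h : 0 ≤ ∑ i, ∑ j, A i j ^ 2 :=
    Finset.sum_nonneg fun i _ => Finset.sum_nonneg fun j _ => sq_nonneg _
  have h' : frobNorm A * frobNorm A = ∑ i, ∑ j, A i j ^ 2 := Real.mul_self_sqrt h
  rw [h', Finset.sum_comm]
  simp [Matrix.trace, Matrix.mul_apply, sq]

/-- The guarantee for every fixed matrix implies the one for a random matrix with orthonormal
columns, by Fubini's theorem. -/
theorem HasAMM.random_orthonormal {m d n : ℕ} (hnd : n ≤ d)
    {μ : Measure (Matrix (Fin m) (Fin d) ℝ)} [IsProbabilityMeasure μ] {ε : ℝ}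
    (h : HasAMM μ n ε (1 / 10)) :
    9 / 10 ≤ ((uniformOrthonormal d n).prod μ).real
      {p | frobNorm (p.1ᵀ * p.2ᵀ * p.2 * p.1 - 1) ≤ ε * n} := by
  have hmeas := measurableSet_frobNorm_gram_sub_one_le m d n (ε * n)
  rw [measureReal_def, ← ENNReal.ofReal_le_iff_le_toReal (measure_ne_top _ _),
    Measure.prod_apply hmeas, uniformOrthonormal,
    lintegral_map (measurable_measure_prodMk_left hmeas) (measurable_firstColumns_coe d n)]
  calc ENNReal.ofReal (9 / 10)
      = ∫⁻ _Q : Matrix.orthogonalGroup (Fin d) ℝ, ENNReal.ofReal (9 / 10) ∂haarOrthogonal d := by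
        simp
    _ ≤ _ := lintegral_mono fun Q => ?_
  refine (ENNReal.ofReal_le_iff_le_toReal (measure_ne_top _ _)).2 ?_
  have hQ := h (firstColumns n Q.1)
  simp only [SatisfiesAMM, frobNorm_mul_self, transpose_mul_firstColumns hnd, Matrix.trace_one,
    Fintype.card_fin] at hQ
  norm_num at hQ
  simpa [measureReal_def] using hQ

/-- Padding with zero columns. -/
theorem HasAMM.mono_columns {m d k n : ℕ} (hkn : k ≤ n)
    {μ : Measure (Matrix (Fin m) (Fin d) ℝ)} {ε δ : ℝ} (h : HasAMM μ n ε δ) :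
    HasAMM μ k ε δ := by
  intro A
  -- `A * P` is `A` padded with zero columns
  let P : Matrix (Fin k) (Fin n) ℝ :=
    Matrix.of fun i j => if Fin.castLE hkn i = j then 1 else 0
  have hP : P * Pᵀ = 1 := by
    ext i j
    simp [P, Matrix.mul_apply, Matrix.one_apply, eq_comm]
  have hfrob (M : Matrix (Fin k) (Fin k) ℝ) : frobNorm (Pᵀ * M * P) = frobNorm M := by
    have h1 : (Pᵀ * M * P)ᵀ * (Pᵀ * M * P) = Pᵀ * (Mᵀ * (P * Pᵀ) * M * P) := by
      simp only [Matrix.transpose_mul, Matrix.transpose_transpose, Matrix.mul_assoc]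
    rw [frobNorm_eq_sqrt_trace, frobNorm_eq_sqrt_trace, h1, hP, Matrix.mul_one,
      Matrix.trace_mul_comm, Matrix.mul_assoc, hP, Matrix.mul_one]
  have hfrob' : frobNorm (A * P) * frobNorm (A * P) = frobNorm A * frobNorm A := by
    rw [frobNorm_mul_self, frobNorm_mul_self, Matrix.transpose_mul, ← Matrix.mul_assoc,
      Matrix.trace_mul_comm, ← Matrix.mul_assoc, ← Matrix.mul_assoc, hP, Matrix.one_mul]
  have hiff (S : Matrix (Fin m) (Fin d) ℝ) :
      SatisfiesAMM ε S (A * P) (A * P) ↔ SatisfiesAMM ε S A A := by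
    have h1 : (A * P)ᵀ * Sᵀ * S * (A * P) - (A * P)ᵀ * (A * P)
        = Pᵀ * (Aᵀ * Sᵀ * S * A - Aᵀ * A) * P := by
      simp only [Matrix.transpose_mul, Matrix.mul_sub, Matrix.sub_mul, Matrix.mul_assoc]
    rw [SatisfiesAMM, SatisfiesAMM, h1, hfrob, hfrob']
  simpa only [hiff] using h (A * P)

/-- The lower bound under the guarantee for every fixed matrix, for all `d ≥ 1 / ε ^ 2`: by zero
padding it is enough to have the guarantee for a single column. -/
theorem HasAMM.le_rows {n : ℕ} {ε : ℝ} (hn : 1 ≤ n) (hε : 0 < ε)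
    (hεn : ε ≤ 1 / 10 / Real.sqrt n) {d : ℕ} (hd : 1 / ε ^ 2 ≤ d) {m : ℕ}
    {μ : Measure (Matrix (Fin m) (Fin d) ℝ)} [IsProbabilityMeasure μ]
    (h : HasAMM μ n ε (1 / 10)) : 1 / 1280000 / ε ^ 2 ≤ m := by
  have hε' : ε ≤ 1 / 10 := hεn.trans <| div_le_self (by norm_num) <|
    Real.one_le_sqrt.2 (by exact_mod_cast hn)
  have hd1 : 1 ≤ d := by
    have h1 : (0 : ℝ) < d := lt_of_lt_of_le (by positivity) hd
    exact_mod_cast h1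
  exact le_rows_of_random_orthonormal le_rfl hε (by simpa using hε') (by simpa using hd) μ
    ((h.mono_columns hn).random_orthonormal hd1)

theorem mainTheorem3 :
    -- the lower bound for all `d ≥ D / ε ^ 2`
    (∃ c > (0 : ℝ), ∃ C > (0 : ℝ), ∃ D > (0 : ℝ),
      ∀ (n : ℕ) (ε : ℝ), 1 ≤ n → 0 < ε → ε < c / Real.sqrt n →
      ∀ (d : ℕ), D / ε ^ 2 ≤ d →
      ∀ (m : ℕ) (μ : Measure (Matrix (Fin m) (Fin d) ℝ)), IsProbabilityMeasure μ →
        HasAMM μ n ε (1 / 10) →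
        C / ε ^ 2 ≤ m) ∧
    -- the lower bound for all `d ≥ D n / ε ^ 2`, also under the weaker guarantee
    (∃ c > (0 : ℝ), ∃ C > (0 : ℝ), ∃ D > (0 : ℝ),
      ∀ (n : ℕ) (ε : ℝ), 1 ≤ n → 0 < ε → ε ≤ c / Real.sqrt n →
      ∀ (d : ℕ), D * n / ε ^ 2 ≤ d →
      ∀ (m : ℕ) (μ : Measure (Matrix (Fin m) (Fin d) ℝ)), IsProbabilityMeasure μ →
        (HasAMM μ n ε (1 / 10) → C / ε ^ 2 ≤ m) ∧
        (9 / 10 ≤ ((uniformOrthonormal d n).prod μ).real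
            {p | frobNorm (p.1ᵀ * p.2ᵀ * p.2 * p.1 - 1) ≤ ε * n} →
          C / ε ^ 2 ≤ m)) := by
  constructor
  · refine ⟨1 / 10, by norm_num, 1 / 1280000, by norm_num, 1, one_pos, ?_⟩
    intro n ε hn hε hεn d hd m μ _ h
    exact h.le_rows hn hε hεn.le hd
  · refine ⟨1 / 10, by norm_num, 1 / 1280000, by norm_num, 1, one_pos, ?_⟩
    intro n ε hn hε hεn d hd m μ _
    refine ⟨fun h => h.le_rows hn hε hεn (le_trans ?_ hd),
      le_rows_of_random_orthonormal hn hε hεn hd μ⟩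
    have hn1 : (1 : ℝ) ≤ n := by exact_mod_cast hn
    gcongr
    linarith
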